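/- Let $X$ be a nonempty finite set and let $\mathcal{L}$ be the set of preferences (linear orders) on $X$, written as strings of alternatives in descending order. Two preferences are $k$-compatible ($0\le k\le |X|$) if they have the same set of $k$ best alternatives; the $k$-conjugates of a $k$-compatible pair $\succ_1,\succ_2$ are the preferences $\succ_1'$ (the $k$ best alternatives ordered as in $\succ_1$, followed by the $|X|-k$ worst ordered as in $\succ_2$) and $\succ_2'$ (the same with the roles of $\succ_1,\succ_2$ exchanged). A Ryser swap is a signed measure $\mathbb{1}_{\{\succ_1',\succ_2'\}}-\mathbb{1}_{\{\succ_1,\succ_2\}}\in\mathbb{R}^{\mathcal{L}}$ with $\succ_1,\succ_2$ $k$-compatible and $\succ_1',\succ_2'$ their $k$-conjugates, for some $k$; $\mathcal{R}\subseteq\mathbb{R}^{\mathcal{L}}$ denotes the span of all Ryser swaps. Let $\succ_1,\dots,\succ_N$ be a finite sequence of preferences, repetition allowed, and let $x^k_n$ be the $k$-th best alternative of $\succ_n$. A rearrangement of it is a family of permutations $\sigma_1,\dots,\sigma_{|X|}$ of $\{1,\dots,N\}$ such that, for all $k$ and $n$, $\succ_n$ and $\succ_{\sigma_k(n)}$ are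 $(k-1)$-compatible. A sequence $\succ_1',\dots,\succ_N'$ is rearrangement equivalent to $\succ_1,\dots,\succ_N$ if there is such a rearrangement for which, for all $n$ and $k$, the $k$-th best alternative of $\succ_n'$ is $x^k_m$ with $m=(\sigma_1\circ\sigma_2\circ\cdots\circ\sigma_k)^{-1}(n)$. Two sequences of length $N$ are called distinct if they differ by more than the order of their terms, i.e. if some preference does not occur equally often in both. **Theorem.** Let $\mathcal{M}=\{\mu\in\Delta(\mathcal{L}) : \mathrm{supp}(\mu)\subseteq\mathcal{S}\}$ for some $\mathcal{S}\subseteq\mathcal{L}$ (a support restriction), and let $\mu\in\mathcal{M}$. Then the following are equivalent: (i) $\mu$ is an extreme point of $(\mu+\mathcal{R})\cap\mathcal{M}$; (ii) there is no pair of distinct, rearrangement-equivalent finite sequences all of whose terms lie in $\mathrm{supp}(\mu)$; (iii) the choice-function vectors $\big(\mathbb{1}\{x\in A,\ x\succ y \text{ for all } y\in A\setminus\{x\}\}\big)_{x\in X,\ \varnothing\ne A\subseteq X}$ of the preferences $\succ\,\in\mathrm{supp}(\mu)$ are linearly independent. -/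

import Mathlib

namespace RandomUtility

/-- A preference on `X`: a linear order, i.e. a complete, transitive and antisymmetric binary
relation. `p.rel x y` says that `x` is weakly preferred to `y`. -/
@[ext] structure Preference (X : Type*) where
  rel : X → X → Prop
  total : ∀ x y, rel x y ∨ rel y x
  trans : ∀ x y z, rel x y → rel y z → rel x z
  antisymm : ∀ x y, rel x y → rel y x → x = y

/-- There are finitely many preferences on a finite set. -/
noncomputable instance instFintypePreference (X : Type*) [Fintype X] :
    Fintype (Preference X) :=
  haveI : Finite (Preference X) :=
    Finite.of_injective (fun p : Preference X => p.rel) fun _ _ h => Preference.ext h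
  Fintype.ofFinite _

namespace Preference

variable {X : Type*} [Fintype X]

/-- The number of alternatives which are strictly preferred to `x` (the best alternative has
rank `0`). -/
noncomputable def rank (p : Preference X) (x : X) : ℕ :=
  {y : X | p.rel y x ∧ y ≠ x}.ncard

theorem rank_lt_of_rel (p : Preference X) {x y : X} (h : p.rel x y) (hne : x ≠ y) :
    p.rank x < p.rank y := by
  refine Set.ncard_lt_ncard ⟨?_, ?_⟩ (Set.toFinite _)
  · rintro z ⟨hz, hzx⟩
    refine ⟨p.trans _ _ _ hz h, ?_⟩
    rintro rfl
    exact hzx (p.antisymm _ _ hz h)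
  · intro hsub
    exact (hsub (show x ∈ {z : X | p.rel z y ∧ z ≠ y} from ⟨h, hne⟩)).2 rfl

theorem rank_injective (p : Preference X) : Function.Injective p.rank := by
  intro x y h
  by_contra hne
  rcases p.total x y with hxy | hyx
  · exact absurd h (p.rank_lt_of_rel hxy hne).ne
  · exact absurd h (p.rank_lt_of_rel hyx (Ne.symm hne)).ne'

theorem rank_lt_card (p : Preference X) (x : X) : p.rank x < Fintype.card X := by
  rw [← Nat.card_eq_fintype_card, ← Set.ncard_univ]
  refine Set.ncard_lt_ncard ⟨Set.subset_univ _, ?_⟩ (Set.toFinite _)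
  intro hsub
  exact (hsub (Set.mem_univ x)).2 rfl

/-- The ranking as a bijection between `X` and the set of positions. -/
noncomputable def rankEquiv (p : Preference X) : X ≃ Fin (Fintype.card X) :=
  Equiv.ofBijective (fun x => (⟨p.rank x, p.rank_lt_card x⟩ : Fin (Fintype.card X))) <| by
    rw [Fintype.bijective_iff_injective_and_card]
    refine ⟨?_, by simp⟩
    intro x y h
    exact p.rank_injective (Fin.mk.inj_iff.mp h)

/-- The alternative in position `k` of the string representing `p`. Positions are counted from
`0`, so this is the `(k + 1)`-th most preferred alternative. -/
noncomputable def alt (p : Preference X) (k : Fin (Fintype.card X)) : X :=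
  p.rankEquiv.symm k

/-- The set of the `k` best alternatives. -/
def best (p : Preference X) (k : ℕ) : Set X :=
  {x | p.rank x < k}

/-- `k`-compatibility: both preferences have the same set of `k` best alternatives. -/
def Compatible (k : ℕ) (p q : Preference X) : Prop :=
  p.best k = q.best k

/-- `r` is the concatenation of the string of the `k` best alternatives of `p` (in the order of
`p`) with the string of the `|X| - k` worst alternatives of `q` (in the order of `q`). -/
def IsConcat (k : ℕ) (p q r : Preference X) : Prop :=
  ∀ i : Fin (Fintype.card X), r.alt i = if (i : ℕ) < k then p.alt i else q.alt i

open Classical in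
/-- The choice function of `p` as a `0`-`1` vector: its entry at an alternative `x` and a menu
(a nonempty set of alternatives) `A` is `1` if `x` is the best element of `A`, and `0` otherwise
(in particular if `x` is not in `A`). -/
noncomputable def choiceVector (p : Preference X) :
    X × {A : Set X // A.Nonempty} → ℝ :=
  fun a => if a.1 ∈ a.2.1 ∧ ∀ y ∈ a.2.1, p.rel a.1 y then 1 else 0

end Preference

open Preference

variable {X : Type*} [Fintype X]

/-- A signed measure on the set of preferences is a Ryser swap if it is the difference between
the indicator of the pair of `k`-conjugates of a `k`-compatible pair and the indicator of that
pair. -/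
def IsRyserSwap (R : Preference X → ℝ) : Prop :=
  ∃ k ≤ Fintype.card X, ∃ p q p' q' : Preference X,
    Compatible k p q ∧ IsConcat k p q p' ∧ IsConcat k q p q' ∧
      R = Set.indicator {p', q'} (fun _ => (1 : ℝ)) - Set.indicator {p, q} (fun _ => (1 : ℝ))

variable (X) in
/-- The Ryser subspace: the span of the Ryser swaps. -/
def ryserSubspace : Submodule ℝ (Preference X → ℝ) :=
  Submodule.span ℝ {R | IsRyserSwap R}

/-- `M` is the set of all probability distributions on preferences whose support lies in some
given set `S` of preferences. -/
def IsSupportRestriction (M : Set (Preference X → ℝ)) : Prop :=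
  ∃ S : Set (Preference X), M = {μ | μ ∈ stdSimplex ℝ (Preference X) ∧ Function.support μ ⊆ S}

/-- The set `(μ + 𝓡) ∩ M`, where `𝓡` is the Ryser subspace. -/
def identifiedSet (μ : Preference X → ℝ) (M : Set (Preference X → ℝ)) :
    Set (Preference X → ℝ) :=
  {ν | ∃ R ∈ ryserSubspace X, ν = μ + R} ∩ M

/-- A rearrangement of the sequence `p`: for every position `k` (counted from `0`), a permutation
of the indices which maps every class of the partition into `k`-compatible preferences
to itself. -/
def IsRearrangement {N : ℕ} (p : Fin N → Preference X)
    (σ : Fin (Fintype.card X) → Equiv.Perm (Fin N)) : Prop :=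
  ∀ (k : Fin (Fintype.card X)) (n : Fin N), Compatible (k : ℕ) (p n) (p (σ k n))

/-- `p'` arises from `p` through a rearrangement `σ`: the alternative of `p' n` in position `k` is
that of `p m` in position `k`, where `m` is the preimage of `n` under `σ 0 ∘ σ 1 ∘ ⋯ ∘ σ k`
(`Fin.partialProd σ k.succ` is this composition). So if `p m` supplies position `k`, then
position `k + 1` is supplied by `p ((σ (k + 1))⁻¹ m)`, which is `(k + 1)`-compatible with `p m`. -/
def RearrangementEquivalent {N : ℕ} (p p' : Fin N → Preference X) : Prop :=
  ∃ σ : Fin (Fintype.card X) → Equiv.Perm (Fin N), IsRearrangement p σ ∧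
    ∀ (n : Fin N) (k : Fin (Fintype.card X)),
      (p' n).alt k = (p ((Fin.partialProd σ k.succ)⁻¹ n)).alt k

/-- The two sequences do not differ merely in the order of their terms: some preference does not
appear equally often in both. -/
def DistinctSequences {N : ℕ} (p p' : Fin N → Preference X) : Prop :=
  ¬ ∃ π : Equiv.Perm (Fin N), p' = p ∘ π

/-- `T` contains a pair of distinct, rearrangement-equivalent (finite) sequences; repetitions of
terms are allowed. -/
def ContainsDistinctEquivalentPair (T : Set (Preference X)) : Prop :=
  ∃ (N : ℕ) (p p' : Fin N → Preference X),
    (∀ n, p n ∈ T) ∧ (∀ n, p' n ∈ T) ∧ DistinctSequences p p' ∧ RearrangementEquivalent p p'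

end RandomUtility

/-!
All three conditions say that no nonzero signed measure `f` carried by the support of `μ` has zero
marginals, i.e. satisfies `∑ f p = 0`, summed over the preferences `p` for which `B` is the set of
alternatives above `x`, for all `x` and `B`. (A preference is a maximal chain from `∅` to the set of
all alternatives, and zero marginals say that `f` puts no net weight on any edge.)

* Linear independence: choosing `x` from `A` means that the set above `x` is disjoint from `A`.
  Möbius inversion over the menus turns `∑ f p • p.choiceVector = 0` into zero marginals
  (`sum_smul_choiceVector_eq_zero_iff`).
* Extremality: a nonzero `f` in the Ryser subspace carried by the support of `μ` is a direction in
  which `μ` can be moved both ways, and the Ryser subspace is exactly the space of signed measures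
  with zero marginals (`mem_ryserSubspace_iff`). To see that it is large enough, fix a preference
  `r` and write the point mass at `p` as a telescoping sum over the preferences which put longer and
  longer top segments of `p` above the rest of `r`. Modulo Ryser swaps each increment depends only
  on one edge of `p` (`glue_add_glue_sub_mem_ryserSubspace`), so summing against `f` gives
  zero.
* Sequences: the multiplicities in two rearrangement-equivalent sequences have a difference with
  zero marginals (`RearrangementEquivalent.zeroMarginals`). Conversely the marginal conditions are
  integral, so a nonzero real solution yields a nonzero integer one with no larger support
  (`exists_int_zeroMarginals`). Its positive and negative parts are the multiplicities of two
  sequences with the same edges at each position; matching these edges position by position and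
  comparing consecutive matchings yields the rearrangement
  (`rearrangementEquivalent_of_forall_perm`).
-/

namespace RandomUtility

/-! ### Strict upper sets, concatenations and gluing -/

namespace Preference

variable {X : Type*}

/-- The set of alternatives strictly preferred to `x`. For an alternative `x` in position `k`, the
pair of `p.above x` and `x` is the `k`-th edge of the path from `∅` to the whole set which
represents `p` in the lattice of sets of alternatives. -/
def above (p : Preference X) (x : X) : Set X :=
  {y | p.rel y x ∧ y ≠ x}

theorem notMem_above (p : Preference X) (x : X) : x ∉ p.above x :=
  fun h => h.2 rfl

theorem rel_refl (p : Preference X) (x : X) : p.rel x x :=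
  (p.total x x).elim id id

theorem rel_iff_notMem_above (p : Preference X) (x y : X) : p.rel x y ↔ y ∉ p.above x := by
  constructor
  · rintro h ⟨h1, h2⟩
    exact h2 (p.antisymm _ _ h1 h)
  · intro h
    rcases p.total x y with h1 | h1
    · exact h1
    · by_cases hxy : y = x
      · exact hxy ▸ p.rel_refl y
      · exact absurd ⟨h1, hxy⟩ h

theorem eq_of_above_eq {p q : Preference X} (h : ∀ x, p.above x = q.above x) : p = q := by
  ext x y
  rw [rel_iff_notMem_above, rel_iff_notMem_above, h]

theorem rank_eq_ncard_above (p : Preference X) (x : X) : p.rank x = (p.above x).ncard :=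
  rfl

theorem best_zero (p : Preference X) : p.best 0 = ∅ := by
  ext x
  simp [best]

theorem Compatible.rank_lt_iff {k : ℕ} {p q : Preference X} (h : Compatible k p q) (x : X) :
    p.rank x < k ↔ q.rank x < k :=
  Set.ext_iff.1 h x

theorem rank_eq_of_above_eq {p q : Preference X} {x : X} (h : p.above x = q.above x) :
    p.rank x = q.rank x := by
  rw [rank_eq_ncard_above, rank_eq_ncard_above, h]

theorem mem_best_iff (p : Preference X) (k : ℕ) (x : X) : x ∈ p.best k ↔ p.rank x < k :=
  Iff.rfl

variable [Fintype X]

theorem mem_above_iff (p : Preference X) (x y : X) : y ∈ p.above x ↔ p.rank y < p.rank x := by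
  constructor
  · rintro ⟨h1, h2⟩
    exact p.rank_lt_of_rel h1 h2
  · intro h
    by_contra h'
    rw [← rel_iff_notMem_above] at h'
    by_cases hxy : x = y
    · exact h.ne (by rw [hxy])
    · exact absurd (p.rank_lt_of_rel h' hxy) (by omega)

theorem above_eq_best (p : Preference X) (x : X) : p.above x = p.best (p.rank x) := by
  ext y
  exact p.mem_above_iff x y

theorem rank_alt (p : Preference X) (k : Fin (Fintype.card X)) : p.rank (p.alt k) = k :=
  congrArg Fin.val (p.rankEquiv.apply_symm_apply k)

theorem alt_rankEquiv (p : Preference X) (x : X) : p.alt (p.rankEquiv x) = x :=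
  p.rankEquiv.symm_apply_apply x

theorem rankEquiv_val (p : Preference X) (x : X) : (p.rankEquiv x : ℕ) = p.rank x :=
  rfl

theorem alt_eq_iff (p : Preference X) (k : Fin (Fintype.card X)) (x : X) :
    p.alt k = x ↔ p.rank x = k := by
  constructor
  · rintro rfl
    exact p.rank_alt k
  · intro h
    exact p.rank_injective (by rw [rank_alt, h])

theorem above_alt (p : Preference X) (k : Fin (Fintype.card X)) :
    p.above (p.alt k) = p.best k := by
  rw [above_eq_best, rank_alt]

theorem best_succ (p : Preference X) (k : Fin (Fintype.card X)) :
    p.best (k + 1) = insert (p.alt k) (p.best k) := by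
  ext x
  have h : x = p.alt k ↔ p.rank x = k := by rw [← alt_eq_iff, eq_comm]
  simp only [best, Set.mem_ofPred_eq, Set.mem_insert_iff, h]
  omega

theorem IsConcat.rank_eq_of_lt {k : ℕ} {p q r : Preference X} (h : IsConcat k p q r) {x : X}
    (hx : p.rank x < k) : r.rank x = p.rank x := by
  have := h (p.rankEquiv x)
  rw [rankEquiv_val, if_pos hx, alt_rankEquiv] at this
  exact (r.alt_eq_iff _ _).1 this

theorem IsConcat.rank_eq_of_le {k : ℕ} {p q r : Preference X} (h : IsConcat k p q r) {x : X}
    (hx : k ≤ q.rank x) : r.rank x = q.rank x := by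
  have := h (q.rankEquiv x)
  rw [rankEquiv_val, if_neg hx.not_gt, alt_rankEquiv] at this
  exact (r.alt_eq_iff _ _).1 this

theorem IsConcat.above_eq_of_lt {k : ℕ} {p q r : Preference X} (hc : Compatible k p q)
    (h : IsConcat k p q r) {x : X} (hx : p.rank x < k) : r.above x = p.above x := by
  ext y
  rw [mem_above_iff, mem_above_iff, h.rank_eq_of_lt hx]
  by_cases hy : p.rank y < k
  · rw [h.rank_eq_of_lt hy]
  · have hy' : k ≤ q.rank y := by rw [hc.rank_lt_iff] at hy; omega
    rw [h.rank_eq_of_le hy']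
    omega

theorem IsConcat.above_eq_of_le {k : ℕ} {p q r : Preference X} (hc : Compatible k p q)
    (h : IsConcat k p q r) {x : X} (hx : k ≤ q.rank x) : r.above x = q.above x := by
  ext y
  rw [mem_above_iff, mem_above_iff, h.rank_eq_of_le hx]
  by_cases hy : p.rank y < k
  · have hy' : q.rank y < k := (hc.rank_lt_iff y).1 hy
    rw [h.rank_eq_of_lt hy]
    omega
  · have hy' : k ≤ q.rank y := by rw [hc.rank_lt_iff] at hy; omega
    rw [h.rank_eq_of_le hy']

theorem isConcat_of_above_eq {k : ℕ} {p q r : Preference X}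
    (h1 : ∀ x, p.rank x < k → r.above x = p.above x)
    (h2 : ∀ x, k ≤ q.rank x → r.above x = q.above x) : IsConcat k p q r := by
  intro i
  rw [alt_eq_iff]
  split_ifs with hi
  · rw [rank_eq_of_above_eq (h1 _ (by rwa [rank_alt])), rank_alt]
  · rw [rank_eq_of_above_eq (h2 _ (by rw [rank_alt]; omega)), rank_alt]

/-- The preference which ranks the `k` best alternatives of `p` first, in the order of `p`, and
all others below, in the order of `q`. No compatibility is required. -/
def glue (k : ℕ) (p q : Preference X) : Preference X where
  rel x y := (p.rank x < k ∧ (p.rank y < k → p.rank x ≤ p.rank y)) ∨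
    (k ≤ p.rank x ∧ k ≤ p.rank y ∧ q.rank x ≤ q.rank y)
  total x y := by omega
  trans x y z := by omega
  antisymm x y h h' := by
    by_cases hx : p.rank x < k
    · exact p.rank_injective (by omega)
    · exact q.rank_injective (by omega)

theorem above_glue_of_lt {k : ℕ} {p q : Preference X} {x : X} (hx : p.rank x < k) :
    (glue k p q).above x = p.above x := by
  ext y
  have : ¬ p.rank y < p.rank x ↔ (glue k p q).rel x y := by
    simp only [glue]
    omega
  rw [← not_iff_not, ← rel_iff_notMem_above, ← this, mem_above_iff]

theorem above_glue_of_le {k : ℕ} {p q : Preference X} {x : X} (hx : k ≤ p.rank x) :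
    (glue k p q).above x = {y | p.rank y < k ∨ q.rank y < q.rank x} := by
  ext y
  have : (glue k p q).rel x y ↔ ¬ (p.rank y < k ∨ q.rank y < q.rank x) := by
    simp only [glue]
    omega
  rw [rel_iff_notMem_above, not_iff_not] at this
  exact this

theorem glue_zero (p q : Preference X) : glue 0 p q = q := by
  refine eq_of_above_eq fun x => ?_
  rw [above_glue_of_le (Nat.zero_le _)]
  ext y
  simp [mem_above_iff]

theorem glue_card (p q : Preference X) : glue (Fintype.card X) p q = p :=
  eq_of_above_eq fun x => above_glue_of_lt (p.rank_lt_card x)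

/-- Gluing at least `k` alternatives of `p` on top does not change the `k` best. -/
theorem rank_glue_lt_iff {j k : ℕ} (hjk : k ≤ j) (p q : Preference X) (x : X)
    (hk : k ≤ Fintype.card X) : (glue j p q).rank x < k ↔ p.rank x < k := by
  by_cases hx : p.rank x < j
  · rw [rank_eq_of_above_eq (above_glue_of_lt hx)]
  · -- the `k` alternatives `p.alt 0, …, p.alt (k - 1)` all lie above `x` after gluing
    have h : k ≤ (glue j p q).rank x := by
      rw [rank_eq_ncard_above]
      let e : Fin k → X := fun i => p.alt (Fin.castLE hk i)
      have he : Function.Injective e := fun a b hab => by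
        have := congrArg p.rank hab
        simp only [e, rank_alt, Fin.val_castLE] at this
        exact Fin.ext this
      have hs : Set.range e ⊆ (glue j p q).above x := by
        rintro _ ⟨i, rfl⟩
        rw [above_glue_of_le (not_lt.1 hx)]
        left
        simp only [e, rank_alt, Fin.val_castLE]
        omega
      have := Set.ncard_le_ncard hs (Set.toFinite _)
      rwa [← Set.image_univ, Set.ncard_image_of_injective _ he, Set.ncard_univ,
        Nat.card_eq_fintype_card, Fintype.card_fin] at this
    omega

end Preference

/-! ### Weight functions with zero marginals -/

open Preference

variable {X : Type*} [Fintype X]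

open Classical in
/-- A weight function on preferences has zero marginals if for every alternative `x` and every
set `B`, the total weight of the preferences for which `B` is exactly the set of alternatives above
`x` vanishes. -/
def ZeroMarginals {A : Type*} [AddCommMonoid A] (f : Preference X → A) : Prop :=
  ∀ (x : X) (B : Set X), ∑ p with p.above x = B, f p = 0

theorem ZeroMarginals.map {A A' : Type*} [AddCommMonoid A] [AddCommMonoid A']
    {f : Preference X → A} (hf : ZeroMarginals f) (φ : A →+ A') :
    ZeroMarginals fun p => φ (f p) := by
  intro x B
  rw [← map_sum, hf x B, map_zero]

/-- Zero marginals annihilate every function which depends only on the alternatives above `x`. -/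
theorem ZeroMarginals.sum_smul_eq_zero {K V : Type*} [Ring K] [AddCommGroup V] [Module K V]
    {f : Preference X → K} (hf : ZeroMarginals f) (x : X) (G : Preference X → V)
    (hG : ∀ p q : Preference X, p.above x = q.above x → G p = G q) :
    ∑ p, f p • G p = 0 := by
  classical
  rw [← Finset.sum_fiberwise Finset.univ (fun p : Preference X => p.above x)]
  refine Finset.sum_eq_zero fun B _ => ?_
  rcases Finset.eq_empty_or_nonempty
    (Finset.univ.filter fun p : Preference X => p.above x = B) with h | ⟨q, hq⟩
  · rw [h, Finset.sum_empty]
  · rw [Finset.mem_filter] at hq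
    have h0 : ∑ p with p.above x = B, f p = 0 := by convert hf x B
    calc ∑ p with p.above x = B, f p • G p
        = ∑ p with p.above x = B, f p • G q := by
          refine Finset.sum_congr rfl fun p hp => ?_
          rw [hG p q ((Finset.mem_filter.1 hp).2.trans hq.2.symm)]
      _ = 0 := by rw [← Finset.sum_smul, h0, zero_smul]

theorem ZeroMarginals.sum_eq_zero [Nonempty X] {K : Type*} [Ring K] {f : Preference X → K}
    (hf : ZeroMarginals f) : ∑ p, f p = 0 := by
  have := hf.sum_smul_eq_zero (Classical.arbitrary X) (fun _ => (1 : K)) fun _ _ _ => rfl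
  simpa using this

/-! ### Choice functions and Ryser swaps -/

open Classical in
/-- Choice from the menu `A` sees only whether some member of `A` lies above `x`. -/
theorem choiceVector_apply (p : Preference X) (x : X) (A : {A : Set X // A.Nonempty}) :
    p.choiceVector (x, A) = if x ∈ A.1 ∧ Disjoint (p.above x) A.1 then 1 else 0 := by
  rw [choiceVector]
  congr 1
  simp only [rel_iff_notMem_above, Set.disjoint_right]

/-- A weight function is annihilated by all choice functions iff its marginals vanish. The
nontrivial direction is a Möbius inversion: the choices of `x` from the menu `Bᶜ` add up the
marginals over the subsets of `B`. -/
theorem sum_smul_choiceVector_eq_zero_iff (f : Preference X → ℝ) :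
    ∑ p, f p • p.choiceVector = 0 ↔ ZeroMarginals f := by
  classical
  constructor
  · intro h x B
    induction B using WellFoundedLT.induction with
    | ind B ih =>
      by_cases hx : x ∈ B
      · refine Finset.sum_eq_zero fun p hp => ?_
        have hp' := (Finset.mem_filter.1 hp).2
        exact absurd (hp' ▸ hx) (p.notMem_above x)
      · have h1 := congrFun h (x, ⟨Bᶜ, x, hx⟩)
        have h2 : ∑ p with p.above x ⊆ B, f p = 0 := by
          rw [Finset.sum_apply, Pi.zero_apply] at h1
          rw [Finset.sum_filter]
          refine Eq.trans (Finset.sum_congr rfl fun p _ => ?_) h1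
          simp [choiceVector_apply, hx, Set.disjoint_compl_right_iff_subset]
        rw [← Finset.sum_fiberwise _ (fun p : Preference X => p.above x),
          Finset.sum_eq_single_of_mem B (Finset.mem_univ _)] at h2
        · rw [← h2, Finset.filter_filter]
          refine Finset.sum_congr (Finset.filter_congr fun p _ => ?_) fun _ _ => rfl
          exact ⟨fun h => ⟨h.le, h⟩, fun h => h.2⟩
        · intro C _ hC
          rw [Finset.filter_filter]
          by_cases hCB : C ⊆ B
          · rw [← ih C (lt_of_le_of_ne hCB hC)]
            refine Finset.sum_congr (Finset.filter_congr fun p _ => ?_) fun _ _ => rfl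
            exact ⟨fun h => h.2, fun h => ⟨h ▸ hCB, h⟩⟩
          · refine Finset.sum_eq_zero fun p hp => ?_
            have hp' := (Finset.mem_filter.1 hp).2
            exact absurd (hp'.2 ▸ hp'.1) hCB
  · intro h
    ext ⟨x, A⟩
    rw [Finset.sum_apply]
    refine h.sum_smul_eq_zero x (fun p => p.choiceVector (x, A)) fun p q hpq => ?_
    rw [choiceVector_apply, choiceVector_apply, hpq]

/-- Conjugates coincide only if the original preferences do; hence a Ryser swap is a difference of
sums of point masses even where the pair is degenerate. -/
theorem indicator_conjugates_eq {k : ℕ} {p q p' q' : Preference X} (hc : Compatible k p q)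
    (hp : IsConcat k p q p') (hq : IsConcat k q p q') [DecidableEq (Preference X)] :
    Set.indicator {p', q'} (fun _ => (1 : ℝ)) - Set.indicator {p, q} (fun _ => (1 : ℝ)) =
      (Pi.single p' 1 + Pi.single q' 1 - (Pi.single p 1 + Pi.single q 1) :
        Preference X → ℝ) := by
  have key : ∀ {a b : Preference X}, a ≠ b →
      Set.indicator {a, b} (fun _ => (1 : ℝ)) = Pi.single a 1 + Pi.single b 1 := by
    intro a b hab
    ext c
    by_cases h1 : c = a
    · subst h1; simp [hab]
    · by_cases h2 : c = b
      · subst h2; simp [h1]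
      · simp [h1, h2]
  by_cases hpq : p = q
  · subst hpq
    have h1 : p' = p := eq_of_above_eq fun x => by
      rcases lt_or_ge (p.rank x) k with h | h
      exacts [hp.above_eq_of_lt hc h, hp.above_eq_of_le hc h]
    have h2 : q' = p := eq_of_above_eq fun x => by
      rcases lt_or_ge (p.rank x) k with h | h
      exacts [hq.above_eq_of_lt hc h, hq.above_eq_of_le hc h]
    rw [h1, h2, sub_self, sub_self]
  · have hpq' : p' ≠ q' := by
      rintro rfl
      refine hpq (eq_of_above_eq fun x => ?_)
      rcases lt_or_ge (p.rank x) k with h | h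
      · rw [← hp.above_eq_of_lt hc h, hq.above_eq_of_lt hc.symm ((hc.rank_lt_iff x).1 h)]
      · have h' : k ≤ q.rank x := by have := hc.rank_lt_iff x; omega
        rw [← hp.above_eq_of_le hc h', ← hq.above_eq_of_le hc.symm h]
    rw [key hpq, key hpq']

theorem sum_filter_single [DecidableEq (Preference X)] (P : Preference X → Prop)
    [DecidablePred P] (a : Preference X) :
    ∑ p with P p, (Pi.single a 1 : Preference X → ℝ) p = if P a then 1 else 0 := by
  simp [Pi.single_apply]

theorem IsRyserSwap.zeroMarginals {R : Preference X → ℝ} (hR : IsRyserSwap R) :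
    ZeroMarginals R := by
  classical
  obtain ⟨k, -, p, q, p', q', hc, hp, hq, rfl⟩ := hR
  intro x B
  rw [indicator_conjugates_eq hc hp hq]
  simp only [Pi.sub_apply, Pi.add_apply, Finset.sum_sub_distrib, Finset.sum_add_distrib]
  simp only [sum_filter_single]
  rcases lt_or_ge (p.rank x) k with h | h
  · rw [hp.above_eq_of_lt hc h, hq.above_eq_of_lt hc.symm ((hc.rank_lt_iff x).1 h)]
    ring
  · have h' : k ≤ q.rank x := by have := hc.rank_lt_iff x; omega
    rw [hp.above_eq_of_le hc h', hq.above_eq_of_le hc.symm h]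
    ring

/-- Moving the boundary of a gluing past `x` changes the point mass, modulo Ryser swaps, by an
amount which depends only on the set of alternatives above `x`. -/
theorem glue_add_glue_sub_mem_ryserSubspace [DecidableEq (Preference X)] {p q : Preference X}
    (r : Preference X) {x : X} (h : p.above x = q.above x) :
    (Pi.single (glue (p.rank x) p r) 1 + Pi.single (glue (q.rank x + 1) q r) 1 -
      (Pi.single (glue (p.rank x + 1) p r) 1 + Pi.single (glue (q.rank x) q r) 1) :
        Preference X → ℝ) ∈ ryserSubspace X := by
  have hkq : q.rank x = p.rank x := (rank_eq_of_above_eq h).symm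
  rw [hkq]
  obtain ⟨k, hk⟩ : ∃ k, k = p.rank x := ⟨_, rfl⟩
  rw [← hk] at hkq ⊢
  have hkX : k ≤ Fintype.card X := hk ▸ (p.rank_lt_card x).le
  have hpq : ∀ y, p.rank y < k ↔ q.rank y < k := fun y => by
    rw [hk, ← mem_above_iff, h, mem_above_iff, hkq, hk]
  have hpq' : ∀ y, p.rank y < k + 1 ↔ q.rank y < k + 1 := fun y => by
    have h1 : p.rank y = k ↔ y = x :=
      ⟨fun h => p.rank_injective (h.trans hk), fun h => by rw [h, hk]⟩
    have h2 : q.rank y = k ↔ y = x :=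
      ⟨fun h => q.rank_injective (h.trans hkq.symm), fun h => by rw [h, hkq]⟩
    have := hpq y
    have := h1.trans h2.symm
    omega
  have hc : Compatible k (glue (k + 1) p r) (glue k q r) := by
    ext y
    rw [mem_best_iff, mem_best_iff, rank_glue_lt_iff (Nat.le_succ k) p r y hkX,
      rank_glue_lt_iff le_rfl q r y hkX, hpq]
  have h1 : IsConcat k (glue (k + 1) p r) (glue k q r) (glue k p r) := by
    refine isConcat_of_above_eq (fun y hy => ?_) fun y hy => ?_
    · rw [rank_glue_lt_iff (Nat.le_succ k) p r y hkX] at hy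
      rw [above_glue_of_lt hy, above_glue_of_lt (by omega)]
    · rw [← not_lt, rank_glue_lt_iff le_rfl q r y hkX, not_lt] at hy
      have := hpq y
      rw [above_glue_of_le hy, above_glue_of_le (by omega)]
      simp only [hpq]
  have h2 : IsConcat k (glue k q r) (glue (k + 1) p r) (glue (k + 1) q r) := by
    refine isConcat_of_above_eq (fun y hy => ?_) fun y hy => ?_
    · rw [rank_glue_lt_iff le_rfl q r y hkX] at hy
      rw [above_glue_of_lt hy, above_glue_of_lt (by omega)]
    · rw [← not_lt, rank_glue_lt_iff (Nat.le_succ k) p r y hkX, not_lt] at hy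
      rcases hy.eq_or_lt with hy | hy
      · obtain rfl : y = x := p.rank_injective (by omega)
        rw [above_glue_of_lt (by omega), above_glue_of_lt (by omega), h]
      · have := hpq' y
        rw [above_glue_of_le (by omega), above_glue_of_le (by omega)]
        simp only [hpq']
  rw [← indicator_conjugates_eq hc h1 h2]
  exact Submodule.subset_span ⟨k, hkX, _, _, _, _, hc, h1, h2, rfl⟩

/-- The Ryser subspace is the space of all signed measures with zero marginals, i.e. of those
which are invisible in choice data. -/
theorem mem_ryserSubspace_iff [Nonempty X] (f : Preference X → ℝ) :
    f ∈ ryserSubspace X ↔ ZeroMarginals f := by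
  classical
  constructor
  · intro hf
    rw [← sum_smul_choiceVector_eq_zero_iff]
    induction hf using Submodule.span_induction with
    | mem R hR => exact (sum_smul_choiceVector_eq_zero_iff R).2 (IsRyserSwap.zeroMarginals hR)
    | zero => simp
    | add a b _ _ ha hb =>
      simp only [Pi.add_apply, add_smul, Finset.sum_add_distrib, ha, hb, add_zero]
    | smul c a _ ha => simp only [Pi.smul_apply, smul_assoc, ← Finset.smul_sum, ha, smul_zero]
  · intro hf
    rcases isEmpty_or_nonempty (Preference X) with _ | ⟨⟨r⟩⟩
    · rw [Subsingleton.elim f 0]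
      exact zero_mem _
    rw [← Submodule.Quotient.mk_eq_zero, ← Submodule.mkQ_apply]
    -- `T k p` is the class of the point mass at `p` with its tail replaced by that of `r`.
    let T : ℕ → Preference X → (Preference X → ℝ) ⧸ ryserSubspace X := fun k p =>
      (ryserSubspace X).mkQ (Pi.single (glue k p r) 1)
    have hT : ∀ x (p q : Preference X), p.above x = q.above x →
        T (p.rank x + 1) p - T (p.rank x) p = T (q.rank x + 1) q - T (q.rank x) q := by
      intro x p q h
      have := (Submodule.Quotient.mk_eq_zero _).2 (glue_add_glue_sub_mem_ryserSubspace r h)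
      rw [← Submodule.mkQ_apply] at this
      simp only [map_sub, map_add] at this
      rw [sub_eq_sub_iff_add_eq_add, eq_comm, ← sub_eq_zero, ← this]
      simp only [T]
      abel
    have hsum : ∀ p : Preference X, (ryserSubspace X).mkQ (Pi.single p 1) =
        T 0 r + ∑ x, (T (p.rank x + 1) p - T (p.rank x) p) := by
      intro p
      have h1 : ∑ x, (T (p.rank x + 1) p - T (p.rank x) p) =
          ∑ k : Fin (Fintype.card X), (T (k + 1) p - T k p) :=
        Fintype.sum_equiv p.rankEquiv _ _ fun x => rfl
      rw [h1, Fin.sum_univ_eq_sum_range (fun k => T (k + 1) p - T k p),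
        Finset.sum_range_sub (fun k => T k p)]
      simp only [T, glue_zero, glue_card]
      abel
    calc (ryserSubspace X).mkQ f
        = ∑ p, f p • (ryserSubspace X).mkQ (Pi.single p 1) := by
          conv_lhs => rw [pi_eq_sum_univ' f]
          simp only [map_sum, map_smul]
      _ = ∑ p, f p • T 0 r +
            ∑ x, ∑ p, f p • (T (p.rank x + 1) p - T (p.rank x) p) := by
          rw [Finset.sum_comm, ← Finset.sum_add_distrib]
          refine Finset.sum_congr rfl fun p _ => ?_
          rw [hsum, smul_add, Finset.smul_sum]
      _ = 0 := by
          rw [← Finset.sum_smul, hf.sum_eq_zero, zero_smul, zero_add]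
          exact Finset.sum_eq_zero fun x _ => hf.sum_smul_eq_zero x _ (hT x)

/-! ### Linear independence and extremality -/

/-- The choice functions of the preferences in `T` are linearly independent iff the zero function
is the only weight function with zero marginals which is carried by `T`. -/
theorem linearIndependent_choiceVector_iff (T : Set (Preference X)) :
    LinearIndependent ℝ (fun p : T => (p : Preference X).choiceVector) ↔
      ∀ f : Preference X → ℝ, Function.support f ⊆ T → ZeroMarginals f → f = 0 := by
  classical
  have h : LinearIndependent ℝ (fun p : T => (p : Preference X).choiceVector) ↔
      LinearIndepOn ℝ (choiceVector (X := X)) ((T.toFinset : Finset (Preference X)) : Set _) := by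
    rw [Set.coe_toFinset]
    rfl
  rw [h, linearIndepOn_finset_iff]
  constructor
  · intro H f hT hf
    rw [← sum_smul_choiceVector_eq_zero_iff] at hf
    have h0 : ∀ p, p ∉ T → f p = 0 := fun p hp => by
      by_contra h
      exact hp (hT h)
    ext p
    by_cases hp : p ∈ T
    · refine H f ?_ p (by simpa using hp)
      rw [← hf]
      refine Finset.sum_subset (Finset.subset_univ _) fun q _ hq => ?_
      rw [h0 q (by simpa using hq), zero_smul]
    · exact h0 p hp
  · intro H f hf p hp
    have := H (T.indicator f) Set.support_indicator_subset (by
      rw [← sum_smul_choiceVector_eq_zero_iff, ← hf]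
      symm
      refine Finset.sum_subset_zero_on_sdiff (Finset.subset_univ _) (fun q hq => ?_) fun q hq => ?_
      · rw [Set.indicator_of_notMem (by simpa using hq), zero_smul]
      · rw [Set.indicator_of_mem (by simpa using hq)])
    have := congrFun this p
    rwa [Set.indicator_of_mem (by simpa using hp)] at this

/-- Extremality in the identified set: there is no nonzero direction in the Ryser subspace along
which `μ` can be perturbed both ways, and these directions are those carried by the support of `μ`. -/
theorem mem_extremePoints_identifiedSet_iff {M : Set (Preference X → ℝ)}
    (hM : IsSupportRestriction M) {μ : Preference X → ℝ} (hμ : μ ∈ M)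
    (hsum : ∀ f ∈ ryserSubspace X, ∑ p, f p = 0) :
    μ ∈ (identifiedSet μ M).extremePoints ℝ ↔
      ∀ f ∈ ryserSubspace X, Function.support f ⊆ Function.support μ → f = 0 := by
  obtain ⟨S, rfl⟩ := hM
  obtain ⟨⟨hμ0, hμ1⟩, hμS⟩ := hμ
  rw [mem_extremePoints]
  constructor
  · rintro ⟨-, H⟩ f hf hsupp
    have hf0 : ∀ p, μ p = 0 → f p = 0 := fun p hp => by
      by_contra h
      exact hsupp h hp
    obtain ⟨ε, hε, hεf⟩ : ∃ ε : ℝ, 0 < ε ∧ ∀ p, |ε * f p| ≤ μ p := by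
      have h : ∀ᶠ ε in nhdsWithin (0 : ℝ) (Set.Ioi 0), ∀ p, |ε * f p| ≤ μ p := by
        rw [Filter.eventually_all]
        intro p
        rcases (hμ0 p).eq_or_lt with h | h
        · simp [← h, hf0 p h.symm]
        · have hcont : ContinuousAt (fun ε : ℝ => |ε * f p|) 0 := by fun_prop
          have := hcont.eventually_lt continuousAt_const (g := fun _ => μ p) (by simpa using h)
          exact (this.filter_mono nhdsWithin_le_nhds).mono fun _ => le_of_lt
      obtain ⟨ε, h1, h2⟩ := (h.and self_mem_nhdsWithin).exists
      exact ⟨ε, h2, h1⟩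
    have hmem : ∀ c : ℝ, |c| = ε → μ + c • f ∈ identifiedSet μ
        {μ | μ ∈ stdSimplex ℝ (Preference X) ∧ Function.support μ ⊆ S} := by
      intro c hc
      refine ⟨⟨c • f, Submodule.smul_mem _ _ hf, rfl⟩, ⟨fun p => ?_, ?_⟩, fun p hp => ?_⟩
      · have h1 := hεf p
        rw [abs_mul, abs_of_pos hε, ← hc, ← abs_mul] at h1
        have := neg_abs_le (c * f p)
        simp only [Pi.add_apply, Pi.smul_apply, smul_eq_mul]
        linarith
      · simp only [Pi.add_apply, Pi.smul_apply, Finset.sum_add_distrib, hμ1, ← Finset.smul_sum,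
          hsum f hf, smul_zero, add_zero]
      · refine hμS fun h => hp ?_
        simp [h, hf0 p h]
    have := (H _ (hmem ε (abs_of_pos hε)) _ (hmem (-ε) (by rw [abs_neg, abs_of_pos hε]))
      ⟨1 / 2, 1 / 2, by norm_num, by norm_num, by norm_num, by
        ext p
        simp only [Pi.add_apply, Pi.smul_apply, smul_eq_mul]
        ring⟩).1
    exact (smul_eq_zero.1 (add_eq_left.1 this)).resolve_left hε.ne'
  · intro H
    refine ⟨⟨⟨0, zero_mem _, (add_zero μ).symm⟩, ⟨hμ0, hμ1⟩, hμS⟩, ?_⟩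
    rintro x₁ ⟨⟨R₁, hR₁, rfl⟩, ⟨h₁, -⟩, -⟩ x₂ ⟨⟨R₂, hR₂, rfl⟩, ⟨h₂, -⟩, -⟩ ⟨a, b, ha, hb, hab, he⟩
    have hzero : ∀ p, μ p = 0 → R₁ p = 0 ∧ R₂ p = 0 := by
      intro p hp
      have e := congrFun he p
      have e₁ := h₁ p
      have e₂ := h₂ p
      simp only [Pi.add_apply, Pi.smul_apply, smul_eq_mul, hp, zero_add] at e e₁ e₂
      have := mul_nonneg ha.le e₁
      have := mul_nonneg hb.le e₂
      exact ⟨(mul_eq_zero.1 (by linarith : a * R₁ p = 0)).resolve_left ha.ne',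
        (mul_eq_zero.1 (by linarith : b * R₂ p = 0)).resolve_left hb.ne'⟩
    rw [H R₁ hR₁ fun p hp h => hp (hzero p h).1, H R₂ hR₂ fun p hp h => hp (hzero p h).2]
    simp

end RandomUtility

namespace RandomUtility

/-! ### Sequences, rearrangements and integer weights -/

open Preference

variable {X : Type*}

/-- The weight function which counts how often a preference occurs in `p`, minus how often it
occurs in `p'`. -/
noncomputable def multiplicityDiff {N : ℕ} (p p' : Fin N → Preference X) (q : Preference X) : ℝ :=
  (Nat.card {n // p n = q} : ℝ) - Nat.card {n // p' n = q}

theorem exists_perm_comp_eq {N : ℕ} {γ : Type*} (a b : Fin N → γ)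
    (h : ∀ c, Nat.card {n // a n = c} = Nat.card {n // b n = c}) :
    ∃ τ : Equiv.Perm (Fin N), ∀ n, b (τ n) = a n := by
  have e : ∀ c, Nonempty ({n // a n = c} ≃ {n // b n = c}) := fun c =>
    ⟨(Finite.equivFinOfCardEq (h c)).trans (Finite.equivFin _).symm⟩
  exact ⟨Equiv.ofFiberEquiv fun c => (e c).some, Equiv.ofFiberEquiv_map _⟩

theorem multiplicityDiff_ne_zero {N : ℕ} {p p' : Fin N → Preference X}
    (h : DistinctSequences p p') : multiplicityDiff p p' ≠ 0 := by
  intro h0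
  refine h ?_
  obtain ⟨τ, hτ⟩ := exists_perm_comp_eq p' p fun q => by
    have := congrFun h0 q
    rw [multiplicityDiff, Pi.zero_apply, sub_eq_zero] at this
    exact_mod_cast this.symm
  exact ⟨τ, funext fun n => (hτ n).symm⟩

theorem support_multiplicityDiff_subset {N : ℕ} {p p' : Fin N → Preference X}
    {T : Set (Preference X)} (hp : ∀ n, p n ∈ T) (hp' : ∀ n, p' n ∈ T) :
    Function.support (multiplicityDiff p p') ⊆ T := by
  intro q hq
  by_contra hqT
  refine hq ?_
  have h1 : IsEmpty {n // p n = q} := ⟨fun n => hqT (n.2 ▸ hp n)⟩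
  have h2 : IsEmpty {n // p' n = q} := ⟨fun n => hqT (n.2 ▸ hp' n)⟩
  simp [multiplicityDiff]

variable [Fintype X]

/-- The strict upper set of `x` records the position of `x` together with the edge at it. -/
theorem Preference.above_eq_iff (q : Preference X) (x : X) (B : Set X)
    (k : Fin (Fintype.card X)) (hk : B.ncard = k) :
    q.above x = B ↔ q.alt k = x ∧ q.best k = B := by
  constructor
  · intro h
    have h1 : q.alt k = x := by rw [alt_eq_iff, rank_eq_ncard_above, h, hk]
    exact ⟨h1, by rw [← above_alt, h1, h]⟩
  · rintro ⟨rfl, h⟩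
    rw [above_alt, h]

/-- The conditions on a rearrangement propagate from position to position: the term that supplies
position `k` of `p' n` has the same `k` best alternatives as `p' n`. -/
theorem best_eq_of_isRearrangement {N : ℕ} {p p' : Fin N → Preference X}
    {σ : Fin (Fintype.card X) → Equiv.Perm (Fin N)} (hσ : IsRearrangement p σ)
    (h : ∀ (n : Fin N) (k : Fin (Fintype.card X)),
      (p' n).alt k = (p ((Fin.partialProd σ k.succ)⁻¹ n)).alt k)
    (n : Fin N) (k : Fin (Fintype.card X)) :
    (p' n).best k = (p ((Fin.partialProd σ k.succ)⁻¹ n)).best k := by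
  have step : ∀ k : Fin (Fintype.card X),
      (p ((Fin.partialProd σ k.succ)⁻¹ n)).best k =
        (p ((Fin.partialProd σ k.castSucc)⁻¹ n)).best k := by
    intro k
    have := hσ k ((Fin.partialProd σ k.succ)⁻¹ n)
    rw [Compatible] at this
    rw [this, Fin.partialProd_succ]
    simp
  have key : ∀ k : Fin (Fintype.card X + 1),
      (p' n).best k = (p ((Fin.partialProd σ k)⁻¹ n)).best k := by
    intro k
    induction k using Fin.induction with
    | zero => simp [best_zero]
    | succ k ih => rw [Fin.val_succ, best_succ, best_succ, h, step,
      ← Fin.val_castSucc k, ih]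
  rw [step, ← Fin.val_castSucc, key]

/-- A rearrangement permutes the edges of each level among the terms of the sequence. -/
theorem RearrangementEquivalent.zeroMarginals {N : ℕ} {p p' : Fin N → Preference X}
    (h : RearrangementEquivalent p p') : ZeroMarginals (multiplicityDiff p p') := by
  classical
  obtain ⟨σ, hσ, h⟩ := h
  intro x B
  have count : ∀ a : Fin N → Preference X,
      ∑ q with q.above x = B, (Nat.card {n // a n = q} : ℝ) =
        Nat.card {n // (a n).above x = B} := by
    intro a
    simp only [Nat.card_eq_fintype_card, Fintype.card_subtype]
    rw [← Nat.cast_sum, Finset.card_eq_sum_card_fiberwise (f := a)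
      (t := Finset.univ.filter fun q : Preference X => q.above x = B) (by simp [Set.MapsTo])]
    congr 1
    refine Finset.sum_congr rfl fun q hq => ?_
    rw [Finset.filter_filter]
    congr 1
    refine Finset.filter_congr fun n _ => ?_
    have hq' := (Finset.mem_filter.1 hq).2
    exact ⟨fun h => ⟨h ▸ hq', h⟩, fun h => h.2⟩
  simp only [multiplicityDiff, Finset.sum_sub_distrib]
  rw [count, count, sub_eq_zero, Nat.cast_inj]
  rcases lt_or_ge B.ncard (Fintype.card X) with hB | hB
  · let k : Fin (Fintype.card X) := ⟨B.ncard, hB⟩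
    refine (Nat.card_congr (Equiv.subtypeEquiv (Fin.partialProd σ k.succ)⁻¹ fun n => ?_)).symm
    rw [above_eq_iff _ _ _ k rfl, above_eq_iff _ _ _ k rfl, h,
      best_eq_of_isRearrangement hσ h]
  · have hne : ∀ q : Preference X, q.above x ≠ B := by
      rintro q rfl
      exact absurd (q.rank_lt_card x) hB.not_gt
    simp [hne]

/-- If for every `k` the edges at position `k` of the terms of `p'` are a permutation of those of
the terms of `p`, then `p'` is a rearrangement of `p`: the permutations compare the matchings at
two consecutive positions. -/
theorem rearrangementEquivalent_of_forall_perm {N : ℕ} {p p' : Fin N → Preference X}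
    (τ : Fin (Fintype.card X) → Equiv.Perm (Fin N))
    (hτ : ∀ k n, (p (τ k n)).alt k = (p' n).alt k ∧ (p (τ k n)).best k = (p' n).best k) :
    RearrangementEquivalent p p' := by
  let π : Fin (Fintype.card X + 1) → Equiv.Perm (Fin N) := Fin.cons 1 fun k => (τ k)⁻¹
  have hπ : Fin.partialProd (fun k : Fin (Fintype.card X) => (π k.castSucc)⁻¹ * π k.succ) = π := by
    have := Fin.partialProd_left_inv π
    simpa [π] using this
  have key : ∀ (j : Fin (Fintype.card X + 1)) n, (p ((π j)⁻¹ n)).best j = (p' n).best j := by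
    intro j n
    refine Fin.cases ?_ (fun k => ?_) j
    · simp [best_zero]
    · have := hτ k n
      simp only [π, Fin.cons_succ, inv_inv]
      rw [Fin.val_succ, best_succ, best_succ, this.1, this.2]
  refine ⟨fun k => (π k.castSucc)⁻¹ * π k.succ, fun k n => ?_, fun n k => ?_⟩
  · have h1 := key k.castSucc (π k.succ n)
    have h2 := (hτ k (π k.succ n)).2
    rw [Compatible, Equiv.Perm.mul_apply]
    rw [Fin.val_castSucc] at h1
    rw [h1, ← h2]
    simp [π]
  · rw [hπ]
    simp [π, (hτ k n).1]

theorem exists_sequence (m : Preference X → ℕ) {N : ℕ} (hN : ∑ q, m q = N) :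
    ∃ p : Fin N → Preference X, (∀ n, m (p n) ≠ 0) ∧
      ∀ G : Preference X → ℤ, ∑ n, G (p n) = ∑ q, m q * G q := by
  let e : Fin N ≃ Σ q, Fin (m q) :=
    (Fintype.equivFinOfCardEq (by simpa using hN)).symm
  refine ⟨fun n => (e n).1, fun n => ?_, fun G => ?_⟩
  · exact (e n).2.pos.ne'
  · rw [Fintype.sum_equiv e (fun n => G (e n).1) (fun a => G a.1) fun _ => rfl,
      Fintype.sum_sigma]
    simp

/-- The positive and the negative part of a nonzero integer weight function with zero marginals
are the multiplicities of two distinct sequences which are rearrangements of each other. -/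
theorem containsDistinctEquivalentPair_of_int [Nonempty X] {T : Set (Preference X)}
    {f : Preference X → ℤ} (hT : Function.support f ⊆ T) (hf : ZeroMarginals f) (hf0 : f ≠ 0) :
    ContainsDistinctEquivalentPair T := by
  classical
  have hparts : ∀ q, ((f q).toNat : ℤ) - ((-f q).toNat : ℤ) = f q := fun q => by omega
  have hN : ∑ q, (-f q).toNat = ∑ q, (f q).toNat := by
    zify
    rw [eq_comm, ← sub_eq_zero, ← Finset.sum_sub_distrib, ← hf.sum_eq_zero]
    exact Finset.sum_congr rfl fun q _ => hparts q
  obtain ⟨p, hp, hpG⟩ := exists_sequence (fun q => (f q).toNat) rfl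
  obtain ⟨p', hp', hpG'⟩ := exists_sequence (fun q => (-f q).toNat) hN
  have hdiff : ∀ G : Preference X → ℤ, ∑ n, G (p n) - ∑ n, G (p' n) = ∑ q, f q * G q := by
    intro G
    rw [hpG, hpG', ← Finset.sum_sub_distrib]
    refine Finset.sum_congr rfl fun q _ => ?_
    rw [← sub_mul, hparts]
  refine ⟨_, p, p', fun n => hT ?_, fun n => hT ?_, ?_, ?_⟩
  · have := hp n
    simp only [Function.mem_support]
    omega
  · have := hp' n
    simp only [Function.mem_support]
    omega
  · rintro ⟨π, rfl⟩
    refine hf0 (funext fun q => ?_)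
    have := hdiff (Pi.single q 1)
    simp only [Function.comp_apply] at this
    rw [Equiv.sum_comp π (fun n => (Pi.single q 1 : Preference X → ℤ) (p n)), sub_self] at this
    simpa [Pi.single_apply] using this.symm
  · have hperm : ∀ k : Fin (Fintype.card X), ∃ τ : Equiv.Perm (Fin (∑ q, (f q).toNat)),
        ∀ n, ((p (τ n)).alt k, (p (τ n)).best k) = ((p' n).alt k, (p' n).best k) := by
      intro k
      refine exists_perm_comp_eq (fun n => ((p' n).alt k, (p' n).best k))
        (fun n => ((p n).alt k, (p n).best k)) ?_
      rintro ⟨x, B⟩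
      -- whether `(x, B)` is the edge of `q` at position `k` can be read off `q.above x`
      have h0 := hdiff fun q => if q.alt k = x ∧ q.best k = B then 1 else 0
      have h1 := hf.sum_smul_eq_zero x
        (fun q : Preference X => if q.alt k = x ∧ q.best k = B then (1 : ℤ) else 0) (by
          intro q q' hqq
          have aux : ∀ r : Preference X, r.alt k = x ∧ r.best k = B ↔
              (r.above x).ncard = k ∧ r.above x = B := fun r => by
            rw [alt_eq_iff, rank_eq_ncard_above]
            refine and_congr_right fun h => ?_
            rw [above_eq_best, rank_eq_ncard_above, h]
          simp only [aux, hqq])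
      simp only [smul_eq_mul] at h1
      rw [h1, sub_eq_zero] at h0
      simp only [Prod.mk.injEq, Nat.card_eq_fintype_card, Fintype.card_subtype]
      simp only [Finset.sum_boole] at h0
      exact_mod_cast h0.symm
    choose τ hτ using hperm
    exact rearrangementEquivalent_of_forall_perm τ fun k n => Prod.mk.inj (hτ k n)

/-- The marginal conditions have integer coefficients, so real solutions yield integer ones: apply
a `ℚ`-linear functional on `ℝ` which does not vanish on some value of `f`, and clear
denominators. -/
theorem exists_int_zeroMarginals {f : Preference X → ℝ} (hf : ZeroMarginals f) (hf0 : f ≠ 0) :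
    ∃ g : Preference X → ℤ, Function.support g ⊆ Function.support f ∧ ZeroMarginals g ∧
      g ≠ 0 := by
  obtain ⟨p, hp⟩ := Function.ne_iff.1 hf0
  obtain ⟨φ, hφ⟩ := Module.Projective.exists_dual_ne_zero ℚ hp
  obtain ⟨b, hb⟩ := IsLocalization.exist_integer_multiples_of_finite (nonZeroDivisors ℤ)
    fun q => φ (f q)
  choose g hg using hb
  have hb0 : (b : ℤ) ≠ 0 := nonZeroDivisors.ne_zero b.2
  have hg' : ∀ q, (g q : ℚ) = (b : ℤ) * φ (f q) := fun q => by simpa using hg q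
  refine ⟨g, fun q hq hfq => hq ?_, fun x B => ?_, fun h => hφ ?_⟩
  · have := hg' q
    rw [hfq, map_zero, mul_zero] at this
    exact_mod_cast this
  · have := hf.map φ.toAddMonoidHom x B
    have h2 : ((∑ p with p.above x = B, g p : ℤ) : ℚ) = 0 := by
      push_cast
      simp only [hg']
      rw [← Finset.mul_sum]
      simp only [LinearMap.toAddMonoidHom_coe] at this
      rw [this, mul_zero]
    exact_mod_cast h2
  · have := hg' p
    rw [h, Pi.zero_apply, Int.cast_zero, eq_comm, mul_eq_zero] at this
    exact this.resolve_left (by exact_mod_cast hb0)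

theorem not_containsDistinctEquivalentPair_iff [Nonempty X] (T : Set (Preference X)) :
    ¬ ContainsDistinctEquivalentPair T ↔
      ∀ f : Preference X → ℝ, Function.support f ⊆ T → ZeroMarginals f → f = 0 := by
  constructor
  · intro h f hT hf
    by_contra hf0
    obtain ⟨g, hgf, hg, hg0⟩ := exists_int_zeroMarginals hf hf0
    exact h (containsDistinctEquivalentPair_of_int (hgf.trans hT) hg hg0)
  · rintro h ⟨N, p, p', hp, hp', hd, he⟩
    exact multiplicityDiff_ne_zero hd
      (h _ (support_multiplicityDiff_subset hp hp') he.zeroMarginals)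

end RandomUtility

theorem theorem2 {X : Type*} [Fintype X] [Nonempty X]
    (M : Set (RandomUtility.Preference X → ℝ)) (hM : RandomUtility.IsSupportRestriction M)
    (μ : RandomUtility.Preference X → ℝ) (hμ : μ ∈ M) :
    (μ ∈ (RandomUtility.identifiedSet μ M).extremePoints ℝ ↔
      ¬ RandomUtility.ContainsDistinctEquivalentPair (Function.support μ)) ∧
    (¬ RandomUtility.ContainsDistinctEquivalentPair (Function.support μ) ↔
      LinearIndependent ℝ
        (fun p : Function.support μ => (p : RandomUtility.Preference X).choiceVector)) := by
  rw [RandomUtility.not_containsDistinctEquivalentPair_iff,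
    RandomUtility.linearIndependent_choiceVector_iff,
    RandomUtility.mem_extremePoints_identifiedSet_iff hM hμ fun f hf =>
      ((RandomUtility.mem_ryserSubspace_iff f).1 hf).sum_eq_zero]
  simp only [RandomUtility.mem_ryserSubspace_iff]
  exact ⟨forall_congr' fun f => forall_comm, trivial⟩
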